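/- Let $G$ be a finite connected graph. At step $1$ one vertex of $G$ is set on fire; at every step $i\ge 2$ all neighbours of vertices on fire catch fire, and one further vertex is set on fire (vertices on fire remain on fire; if no vertex is left that is not on fire, nothing new is set on fire). The burning number $b(G)$ is the least $k$ such that, for a suitable choice of the vertices set on fire, all of $G$ is on fire at the end of step $k$. The growth of $G$ is the least integer $k\ge 0$ such that there is a path $P$ in $G$ (possibly a single vertex) with every vertex of $G$ at distance at most $k$ from $P$. Then for every integer $k\ge 0$ and every finite tree $T$ of growth at most $k$, $$b(T)\le \left\lceil\sqrt{|V(T)|+20k^2}\,\right\rceil .$$ -/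

import Mathlib

namespace SimpleGraph

/-- The set of vertices of `G` on fire at the end of step `i`, when the vertex set on fire at
step `i` is `x (i - 1)`. Nothing is on fire at the end of step `0`. At each step, every neighbour
of a vertex on fire catches fire, vertices on fire stay on fire, and the chosen vertex is set on
fire. (The chosen vertex may already be on fire, in which case the choice is wasted: this
accounts for the steps at which no other vertex is available, and does not affect the least
number of steps needed.) -/
def burned {V : Type*} (G : SimpleGraph V) (x : ℕ → V) : ℕ → Set V
  | 0 => ∅
  | i + 1 => G.burned x i ∪ {w | ∃ u ∈ G.burned x i, G.Adj u w} ∪ {x i}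

/-- `G` is `k`-burnable: for some choice of the vertices that are set on fire, the whole graph is
on fire at the end of step `k`. -/
def IsBurnable {V : Type*} (G : SimpleGraph V) (k : ℕ) : Prop :=
  ∃ x : ℕ → V, G.burned x k = Set.univ

/-- The burning number `b(G)`: the least `k` such that `G` is `k`-burnable. -/
noncomputable def burningNumber {V : Type*} (G : SimpleGraph V) : ℕ :=
  sInf {k | G.IsBurnable k}

/-- The growth of a (connected) graph `G`: the least `k` such that all vertices of `G` are within
distance `k` of some path of `G`. -/
noncomputable def growth {V : Type*} (G : SimpleGraph V) : ℕ :=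
  sInf {k | ∃ (u v : V) (p : G.Walk u v), p.IsPath ∧
    ∀ x : V, ∃ y ∈ p.support, G.dist x y ≤ k}

end SimpleGraph

/-! A ball of radius `r` stays burning-admissible if its centre is lit `r` steps before the end, so
it suffices to cover the graph by balls of radii below `m`. Along a path realizing the growth, the
vertices split into legs of height `h i ≤ k` with at least `1 + h i` vertices each
(`exists_leg_heights`). Balls centred on the path, of radii in `[2k, m)`, are placed greedily from
left to right (`exists_ball_centers`). While at least `2k` radii remain, some ball uses up `2r + 1`
vertices; each later ball wastes at most `k`. Hence `m² - 4k² - 2k²` vertices can be covered. -/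

/-! ### Covering legs on a ray by balls. -/

/-- Greedy step: given legs of heights `h i ≤ k` attached at the vertices `0, 1, 2, …` of a ray and
a finite set `A` of available radii, some ball of radius `r ∈ A` covers an initial segment with
about `2 * r + 1` vertices; nothing is lost if there are many radii to choose from. -/
theorem exists_ball_cover_initial_segment {k : ℕ} {h : ℕ → ℕ} (hk : ∀ i, h i ≤ k) {A : Finset ℕ}
    (hA : A.Nonempty) (hr : ∀ r ∈ A, 2 * k ≤ r) :
    ∃ r ∈ A, ∃ c j : ℕ, (∀ i < j, i + h i ≤ c + r ∧ c + h i ≤ r + i) ∧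
      2 * r + 1 ≤ ∑ i ∈ Finset.range j, (1 + h i) + (if 2 * k ≤ A.card then 0 else k) := by
  -- `b` is the maximum of `h i - i`: centred at `r - b`, the ball reaches the tips of all legs on
  -- its left. Indices beyond `k` cannot matter.
  obtain ⟨b, i₀, hb, hmax⟩ : ∃ b i₀ : ℕ, h i₀ = b + i₀ ∧ ∀ i, h i ≤ i + b := by
    obtain ⟨i₀, hi₀, hm⟩ := Finset.exists_max_image (Finset.range (k + 1))
      (fun i => (h i : ℤ) - i) ⟨0, by simp⟩
    have h0 := hm 0 (by simp)
    refine ⟨h i₀ - i₀, i₀, by omega, fun i => ?_⟩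
    by_cases hi : i < k + 1
    · have := hm i (by simpa using hi)
      omega
    · have := hk i
      omega
  have hbk : b + i₀ ≤ k := hb ▸ hk i₀
  have hex : ∀ r, ∃ i, 2 * r - b < i + h i := fun r => ⟨2 * r + 1, by omega⟩
  classical
  -- The first leg whose tip lies beyond the right end `2r - b` of the ball.
  let J : ℕ → ℕ := fun r => Nat.find (hex r)
  have hJ : ∀ r, 2 * r - b < J r + h (J r) := fun r => Nat.find_spec (hex r)
  have hJlt : ∀ r, ∀ i < J r, i + h i ≤ 2 * r - b := fun r i hi =>
    not_lt.1 (Nat.find_min (hex r) hi)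
  have hJle : ∀ r, J r ≤ 2 * r - b + 1 := fun r => Nat.find_min' (hex r) (by omega)
  have hJge : ∀ r, 2 * r - b < J r + k := fun r => (hJ r).trans_le (by grind)
  have hcover : ∀ r ∈ A, ∀ i < J r, i + h i ≤ (r - b) + r ∧ (r - b) + h i ≤ r + i := by
    intro r hrA i hi
    have := hr r hrA
    have := hJlt r i hi
    have := hmax i
    omega
  have hmem : ∀ r ∈ A, i₀ < J r := by
    intro r hrA
    have := hr r hrA
    have := hJge r
    by_contra hlt
    have := hJ r
    have := hk (J r)
    omega
  have hsum : ∀ r, ∑ i ∈ Finset.range (J r), (1 + h i) = J r + ∑ i ∈ Finset.range (J r), h i := by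
    intro r
    simp [Finset.sum_add_distrib]
  -- If no leg rooted inside the ball sticks out, only `b` is lost on the left, and `h i₀ ≥ b` pays
  -- for it.
  by_cases hgood : ∃ r ∈ A, J r = 2 * r - b + 1
  · obtain ⟨r, hrA, hJr⟩ := hgood
    refine ⟨r, hrA, r - b, J r, hcover r hrA, ?_⟩
    have := Finset.single_le_sum (f := h) (fun i _ => Nat.zero_le _)
      (Finset.mem_range.2 (hmem r hrA))
    have := hr r hrA
    rw [hsum]
    omega
  push Not at hgood
  refine ⟨A.max' hA, A.max'_mem hA, A.max' hA - b, J (A.max' hA), hcover _ (A.max'_mem hA), ?_⟩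
  set R := A.max' hA with hR
  have hRA : R ∈ A := A.max'_mem hA
  have hR2 := hr R hRA
  have hi₀ := hmem R hRA
  have hge := hJge R
  rw [hsum]
  split_ifs with hcard
  -- Every radius is now blocked by a leg, and a leg of height `h i` blocks at most `h i` radii. All
  -- but at most `k` of the `2k` or more radii are blocked strictly between `i₀` and `J R`, so these
  -- legs contain at least `k` extra vertices, which makes up for the loss on the right.
  · have hfib : (A.filter (fun r => 2 * r - b < J R)).card
        ≤ ∑ i ∈ Finset.Ico (i₀ + 1) (J R), h i := by
      rw [Finset.card_eq_sum_card_fiberwise (f := J) (t := Finset.Ico (i₀ + 1) (J R))]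
      · refine Finset.sum_le_sum fun i _ => ?_
        have : (((A.filter (fun r => 2 * r - b < J R)).filter (fun r => J r = i)).card)
            ≤ (Finset.range (h i)).card := by
          refine Finset.card_le_card_of_injOn (fun r => 2 * r - b - i) ?_ ?_
          · intro r hrm
            simp only [Finset.coe_filter, Finset.mem_filter, Set.mem_ofPred_eq] at hrm
            obtain ⟨⟨hrA, -⟩, rfl⟩ := hrm
            have := hJ r
            have := hJle r
            have := hgood r hrA
            simp only [Finset.coe_range, Set.mem_Iio]
            omega
          · intro r hrm s hsm hrs
            simp only [Finset.coe_filter, Finset.mem_filter, Set.mem_ofPred_eq] at hrm hsm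
            obtain ⟨⟨hrA, -⟩, hri⟩ := hrm
            obtain ⟨⟨hsA, -⟩, hsi⟩ := hsm
            have := hJle r
            have := hgood r hrA
            have := hJle s
            have := hgood s hsA
            have := hr r hrA
            have := hr s hsA
            simp only at hrs
            omega
        simpa using this
      · intro r hrm
        simp only [Finset.coe_filter, Set.mem_ofPred_eq] at hrm
        obtain ⟨hrA, hlt⟩ := hrm
        have := hJle r
        have := hgood r hrA
        have := hmem r hrA
        simp only [Finset.coe_Ico, Set.mem_Ico]
        omega
    have hnear : (A.filter (fun r => ¬ 2 * r - b < J R)).card ≤ (Finset.Ioc (R - k) R).card := by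
      refine Finset.card_le_card fun r hrm => ?_
      rw [Finset.mem_filter] at hrm
      have := A.le_max' r hrm.1
      have := hr r hrm.1
      rw [Finset.mem_Ioc]
      omega
    have hsplit := Finset.card_filter_add_card_filter_not (s := A) (fun r => 2 * r - b < J R)
    rw [Nat.card_Ioc] at hnear
    have hle : ∑ i ∈ Finset.Ico (i₀ + 1) (J R), h i + h i₀ ≤ ∑ i ∈ Finset.range (J R), h i := by
      rw [← Finset.sum_range_add_sum_Ico h (Nat.succ_le_of_lt hi₀), Finset.sum_range_succ]
      simp only [Nat.succ_eq_add_one]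
      omega
    omega
  · have := Finset.single_le_sum (f := h) (fun i _ => Nat.zero_le _) (Finset.mem_range.2 hi₀)
    omega

/-- Balls centred on a ray with radii in `A` cover the vertices in `[s, L)` together with the legs
attached to them, provided these do not have too many vertices. -/
theorem exists_ball_centers {k : ℕ} {h : ℕ → ℕ} (hk : ∀ i, h i ≤ k) (L : ℕ) (A : Finset ℕ)
    (hr : ∀ r ∈ A, 2 * k ≤ r) (s : ℕ)
    (hs : ∑ i ∈ Finset.Ico s L, (1 + h i) + k * min A.card (2 * k) ≤ ∑ r ∈ A, (2 * r + 1)) :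
    ∃ c : ℕ → ℕ, ∀ i, s ≤ i → i < L → ∃ r ∈ A, i + h i ≤ c r + r ∧ c r + h i ≤ r + i := by
  induction hn : A.card generalizing A s with
  | zero =>
    obtain rfl := Finset.card_eq_zero.1 hn
    -- With no radii left, `hs` forces `[s, L)` to be empty.
    refine ⟨id, fun i h1 h2 => ?_⟩
    have := Finset.single_le_sum (f := fun i => 1 + h i) (fun i _ => Nat.zero_le _)
      (Finset.mem_Ico.2 ⟨h1, h2⟩)
    simp only [Finset.sum_empty] at hs
    omega
  | succ n ih =>
    have hA : A.Nonempty := Finset.card_pos.1 (by omega)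
    obtain ⟨r, hrA, c, j, hcov, hgain⟩ :=
      exists_ball_cover_initial_segment (h := fun i => h (s + i)) (fun i => hk _) hA hr
    by_cases hj : L ≤ s + j
    · refine ⟨fun _ => s + c, fun i h1 h2 => ⟨r, hrA, ?_⟩⟩
      beta_reduce
      have := hcov (i - s) (by omega)
      rw [Nat.add_sub_cancel' h1] at this
      omega
    · have hcard : (A.erase r).card = n := by rw [Finset.card_erase_of_mem hrA]; omega
      obtain ⟨c', hc'⟩ := ih (A.erase r) (fun q hq => hr q (Finset.mem_of_mem_erase hq)) (s + j)
        (by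
          rw [← Finset.add_sum_erase A _ hrA,
            ← Finset.sum_Ico_consecutive _ (Nat.le_add_right s j) (by omega : s + j ≤ L),
            Finset.sum_Ico_eq_sum_range, Nat.add_sub_cancel_left, hn] at hs
          rw [hcard]
          rw [hn] at hgain
          -- The reserve `k * min A.card (2 * k)` drops by `k` exactly when the ball may waste `k`.
          split_ifs at hgain with hc
          · have : k * min n (2 * k) ≤ k * min (n + 1) (2 * k) := by gcongr; omega
            omega
          · have : k * min (n + 1) (2 * k) = k * min n (2 * k) + k := by
              rw [min_eq_left (by omega), min_eq_left (by omega)]; ring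
            omega) hcard
      refine ⟨Function.update c' r (s + c), fun i h1 h2 => ?_⟩
      by_cases hi : i < s + j
      · refine ⟨r, hrA, ?_⟩
        have := hcov (i - s) (by omega)
        rw [Nat.add_sub_cancel' h1] at this
        rw [Function.update_self]
        omega
      · obtain ⟨q, hq, h3⟩ := hc' i (by omega) h2
        refine ⟨q, Finset.mem_of_mem_erase hq, ?_⟩
        rwa [Function.update_of_ne (Finset.ne_of_mem_erase hq)]

/-! ### From graphs to legs on a ray. -/

namespace SimpleGraph

variable {V : Type*} {G : SimpleGraph V}

theorem burned_mono (x : ℕ → V) : Monotone (G.burned x) :=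
  monotone_nat_of_le_succ fun _ _ hw => Or.inl (Or.inl hw)

theorem mem_burned_add_length (x : ℕ → V) {u w : V} (p : G.Walk u w) {n : ℕ}
    (hu : u ∈ G.burned x n) : w ∈ G.burned x (n + p.length) := by
  induction p generalizing n with
  | nil => exact hu
  | cons hadj q ih =>
    have := ih (n := n + 1) (Or.inl (Or.inr ⟨_, hu, hadj⟩))
    rwa [Walk.length_cons, add_comm q.length, ← add_assoc]

/-- A connected graph covered by balls of radii `0, …, m - 1` is `m`-burnable. -/
theorem Connected.isBurnable_of_dist_le (hG : G.Connected) {m : ℕ} (c : ℕ → V)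
    (hc : ∀ w, ∃ r < m, G.dist (c r) w ≤ r) : G.IsBurnable m := by
  -- The ball of radius `r` starts at step `m - r`, leaving `r` steps to spread.
  refine ⟨fun i => c (m - 1 - i), Set.eq_univ_of_forall fun w => ?_⟩
  obtain ⟨r, hr, hd⟩ := hc w
  obtain ⟨p, hp⟩ := hG.exists_walk_length_eq_dist (c r) w
  have hmem : c r ∈ G.burned (fun i => c (m - 1 - i)) (m - 1 - r + 1) := by
    right
    simp only [Set.mem_singleton_iff]
    congr 1
    omega
  exact burned_mono _ (by omega) (mem_burned_add_length _ p hmem)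

/-- Indices past the end are allowed, as `getVert` is then constant; ball centres may overshoot the
path. -/
theorem Walk.dist_getVert_le {u v : V} (p : G.Walk u v) (i j : ℕ) (hij : i ≤ j) :
    G.dist (p.getVert i) (p.getVert j) ≤ j - i := by
  have h := (dist_le ((p.drop i).take (j - i))).trans
    ((Walk.take_length _ _).trans_le (min_le_left _ _))
  rwa [Walk.drop_getVert, Nat.add_sub_cancel' hij] at h

/-- The vertices of a path are the roots of disjoint legs that together contain all vertices:
`h i` is the height of the leg at the `i`-th vertex. -/
theorem Connected.exists_leg_heights [Fintype V] (hG : G.Connected) {u v : V} {p : G.Walk u v}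
    (hp : p.IsPath) {k : ℕ} (hk : ∀ x, ∃ y ∈ p.support, G.dist x y ≤ k) :
    ∃ h : ℕ → ℕ, (∀ i, h i ≤ k) ∧
      (∀ x, ∃ i ≤ p.length, G.dist x (p.getVert i) ≤ h i) ∧
      ∑ i ∈ Finset.range (p.length + 1), (1 + h i) ≤ Fintype.card V := by
  classical
  have hex : ∀ x, ∃ i, i ≤ p.length ∧
      ∀ j ≤ p.length, G.dist x (p.getVert i) ≤ G.dist x (p.getVert j) := by
    intro x
    obtain ⟨i, hi, hmin⟩ := Finset.exists_min_image (Finset.range (p.length + 1))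
      (fun i => G.dist x (p.getVert i)) ⟨0, by simp⟩
    exact ⟨i, by simpa [Nat.lt_succ_iff] using hi,
      fun j hj => hmin j (by simpa [Nat.lt_succ_iff] using hj)⟩
  -- The nearest path vertex, ties going to the smallest index.
  let π : V → ℕ := fun x => Nat.find (hex x)
  have hπle : ∀ x, π x ≤ p.length := fun x => (Nat.find_spec (hex x)).1
  have hπmin : ∀ x, ∀ j ≤ p.length, G.dist x (p.getVert (π x)) ≤ G.dist x (p.getVert j) :=
    fun x => (Nat.find_spec (hex x)).2
  have hπfirst : ∀ x i, i ≤ p.length →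
      (∀ j ≤ p.length, G.dist x (p.getVert i) ≤ G.dist x (p.getVert j)) → π x ≤ i :=
    fun x i h1 h2 => Nat.find_min' (hex x) ⟨h1, h2⟩
  let F : ℕ → Finset V := fun i => Finset.univ.filter (fun x => π x = i)
  let h : ℕ → ℕ := fun i => (F i).sup (fun x => G.dist x (p.getVert i))
  refine ⟨h, fun i => Finset.sup_le fun x hx => ?_, fun x => ⟨π x, hπle x, ?_⟩, ?_⟩
  · obtain rfl : π x = i := by simpa [F] using hx
    obtain ⟨y, hy, hxy⟩ := hk x
    obtain ⟨j, rfl, hj⟩ := Walk.mem_support_iff_exists_getVert.1 hy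
    exact (hπmin x j hj).trans hxy
  · exact Finset.le_sup (f := fun y => G.dist y (p.getVert (π x))) (by simp [F])
  · have hcard : ∀ i ∈ Finset.range (p.length + 1), 1 + h i ≤ (F i).card := by
      intro i hi
      replace hi : i ≤ p.length := by simpa [Nat.lt_succ_iff] using hi
      have hroot : p.getVert i ∈ F i := by
        have h0 := hπmin (p.getVert i) i hi
        rw [dist_self, Nat.le_zero, hG.dist_eq_zero_iff] at h0
        simpa [F] using (hp.getVert_injOn (hπle _) hi h0.symm)
      obtain ⟨x, hx, hxh⟩ := Finset.exists_mem_eq_sup (F i) ⟨_, hroot⟩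
        (fun x => G.dist x (p.getVert i))
      replace hxh : h i = G.dist x (p.getVert i) := hxh
      replace hx : π x = i := by simpa [F] using hx
      obtain ⟨q, hq⟩ := hG.exists_walk_length_eq_dist x (p.getVert i)
      -- A geodesic from a highest vertex to its root stays in the leg, thanks to the tie-breaking,
      -- so every distance `0, …, h i` occurs.
      have hsub : Finset.range (1 + h i) ⊆ (F i).image (fun y => G.dist y (p.getVert i)) := by
        intro t ht
        replace ht : t ≤ h i := by
          rw [Finset.mem_range] at ht
          omega
        have hd1 : G.dist x (q.getVert (h i - t)) ≤ h i - t := by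
          simpa using q.dist_getVert_le 0 (h i - t) (Nat.zero_le _)
        have hd2 : G.dist (q.getVert (h i - t)) (p.getVert i) ≤ t := by
          have := q.dist_getVert_le (h i - t) q.length (by omega)
          rw [q.getVert_length] at this
          omega
        have htri := hG.dist_triangle (u := x) (v := q.getVert (h i - t)) (w := p.getVert i)
        refine Finset.mem_image.2 ⟨q.getVert (h i - t), ?_, by omega⟩
        set y := q.getVert (h i - t)
        have hbound : ∀ j ≤ p.length, G.dist y (p.getVert i) ≤ G.dist y (p.getVert j) := by
          intro j hj
          have h1 := hπmin x j hj
          rw [hx] at h1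
          have := hG.dist_triangle (u := x) (v := y) (w := p.getVert j)
          omega
        have hyi : π y ≤ i := hπfirst y i hi hbound
        have hiy : i ≤ π y := by
          rw [← hx]
          refine hπfirst x _ (hπle y) fun j hj => ?_
          have h1 := hπmin x j hj
          rw [hx] at h1
          have := hG.dist_triangle (u := x) (v := y) (w := p.getVert (π y))
          have := hπmin y i hi
          omega
        simpa [F] using le_antisymm hyi hiy
      have := (Finset.card_le_card hsub).trans Finset.card_image_le
      simpa using this
    calc ∑ i ∈ Finset.range (p.length + 1), (1 + h i)
        ≤ ∑ i ∈ Finset.range (p.length + 1), (F i).card := Finset.sum_le_sum hcard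
      _ = Fintype.card V := by
        rw [← Finset.card_univ]
        refine (Finset.card_eq_sum_card_fiberwise fun x _ => ?_).symm
        simpa [Nat.lt_succ_iff] using hπle x

/-- There is a path realizing the growth of a finite connected graph. -/
theorem Connected.exists_isPath_dist_le_growth [Finite V] (hG : G.Connected) :
    ∃ (u v : V) (p : G.Walk u v), p.IsPath ∧
      ∀ x : V, ∃ y ∈ p.support, G.dist x y ≤ G.growth := by
  refine Nat.sInf_mem (s := {k | ∃ (u v : V) (p : G.Walk u v), p.IsPath ∧
    ∀ x : V, ∃ y ∈ p.support, G.dist x y ≤ k}) ?_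
  have := Fintype.ofFinite V
  obtain ⟨v⟩ := hG.nonempty
  exact ⟨Finset.univ.sup (fun x => G.dist x v), v, v, Walk.nil, Walk.IsPath.nil, fun x =>
    ⟨v, by simp, Finset.le_sup (f := fun x => G.dist x v) (Finset.mem_univ x)⟩⟩

/-- A connected graph of growth at most `k` with at most `m ^ 2 - 6 * k ^ 2` vertices is
`m`-burnable. -/
theorem Connected.isBurnable_of_growth_le [Fintype V] (hG : G.Connected) {k m : ℕ}
    (hk : G.growth ≤ k) (hm : Fintype.card V + 6 * k ^ 2 ≤ m ^ 2) : G.IsBurnable m := by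
  obtain ⟨u, v, p, hp, hpk⟩ := hG.exists_isPath_dist_le_growth
  obtain ⟨h, hle, hcov, hsum⟩ := hG.exists_leg_heights hp
    (k := k) fun x => (hpk x).imp fun y hy => ⟨hy.1, hy.2.trans hk⟩
  have h2k : 2 * k ≤ m := by nlinarith
  have hodd : ∀ n : ℕ, ∑ r ∈ Finset.range n, (2 * r + 1) = n ^ 2 := by
    intro n
    induction n with
    | zero => simp
    | succ n ih => rw [Finset.sum_range_succ, ih]; ring
  obtain ⟨c, hc⟩ := exists_ball_centers hle (p.length + 1) (Finset.Ico (2 * k) m)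
    (fun r hr => (Finset.mem_Ico.1 hr).1) 0 (by
      have h1 := Finset.sum_range_add_sum_Ico (fun r => 2 * r + 1) h2k
      rw [hodd, hodd] at h1
      have h2 : k * min (Finset.Ico (2 * k) m).card (2 * k) ≤ k * (2 * k) :=
        Nat.mul_le_mul_left _ (min_le_right _ _)
      rw [← Finset.range_eq_Ico]
      nlinarith)
  refine hG.isBurnable_of_dist_le (fun r => p.getVert (c r)) fun w => ?_
  obtain ⟨i, hi, hwi⟩ := hcov w
  obtain ⟨r, hr, h1, h2⟩ := hc i (Nat.zero_le i) (Nat.lt_succ_of_le hi)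
  refine ⟨r, (Finset.mem_Ico.1 hr).2, ?_⟩
  have htri := hG.dist_triangle (u := p.getVert (c r)) (v := p.getVert i) (w := w)
  rw [G.dist_comm (u := p.getVert i) (v := w)] at htri
  rcases le_total (c r) i with hci | hci
  · have := p.dist_getVert_le _ _ hci
    omega
  · have := p.dist_getVert_le _ _ hci
    rw [dist_comm] at this
    omega

end SimpleGraph

theorem mainTheorem5 {V : Type*} [Fintype V] (T : SimpleGraph V) (hT : T.IsTree) (k : ℕ)
    (hk : T.growth ≤ k) :
    T.burningNumber ≤ ⌈√((Fintype.card V : ℝ) + 20 * (k : ℝ) ^ 2)⌉₊ := by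
  -- There is slack here: `6 * k ^ 2` would suffice in place of `20 * k ^ 2`.
  refine Nat.sInf_le (hT.connected.isBurnable_of_growth_le hk ?_)
  have h := Real.sqrt_le_left (Nat.cast_nonneg _) |>.1
    (Nat.le_ceil √((Fintype.card V : ℝ) + 20 * (k : ℝ) ^ 2))
  have h' : Fintype.card V + 20 * k ^ 2 ≤
      ⌈√((Fintype.card V : ℝ) + 20 * (k : ℝ) ^ 2)⌉₊ ^ 2 := by
    exact_mod_cast h
  omega
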